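/- Let $L$ be a frame (complete Heyting algebra) with least element $0$, greatest element $1$ and implication $\to$. For $L$-subsets $A,B\in L^X$ put $\mathrm{sub}(A,B)=\bigwedge_{x\in X}(A(x)\to B(x))$, and call $A$ nonempty if $\bigvee_{x\in X}A(x)=1$. **$L$-orders.** An $L$-ordered set is a set $P$ with $e:P\times P\to L$ such that $e(x,x)=1$, $e(x,y)\wedge e(y,z)\le e(x,z)$, and $e(x,y)\wedge e(y,x)=1$ implies $x=y$. An element $s$ is the supremum $\sqcup A$ of $A\in L^P$ if $e(s,y)=\bigwedge_{x}(A(x)\to e(x,y))$ for all $y\in P$. A nonempty $D\in L^P$ is directed if $D(x)\wedge D(y)\le\bigvee_z D(z)\wedge e(x,z)\wedge e(y,z)$ for all $x,y$. $P$ is an $L$-dcpo if every directed $L$-subset has a supremum. A map $f:P\to Q$ is Scott continuous if for every directed $D\in L^P$ having a supremum, $f(\sqcup D)$ is the supremum of $f^{\rightarrow}(D)$, where $f^{\rightarrow}(D)(y)=\bigvee_{f(x)=y}D(x)$. Put $\Downarrow x(y)=\bigwedge_D\big(e(x,\sqcup D)\to\bigvee_{d}D(d)\wedge e(y,d)\big)$,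 with $D$ ranging over the directed $L$-subsets having a supremum. The element $x$ is compact if $\Downarrow x(x)=1$. Let $k(x)(y)=e(y,x)$ if $y$ is compact and $k(x)(y)=0$ otherwise. An $L$-dcpo $P$ is algebraic if for every $x\in P$ the $L$-subset $k(x)$ is directed and $\sqcup k(x)=x$. **$L$-topologies.** An $L$-topology on $X$ is a family $\mathcal O(X)\subseteq L^X$ closed under binary meets and arbitrary joins and containing all constant maps. A map $f:X\to Y$ is continuous if $B\circ f\in\mathcal O(X)$ for all $B\in\mathcal O(Y)$. A family $\mathcal B\subseteq\mathcal O(X)$ is a base if every $A\in\mathcal O(X)$ has the form $\bigvee_j a_j\wedge B_j$ with $a_j\in L$ and $B_j\in\mathcal B$. A nonempty $A\in L^X$ is super-compact if $\mathrm{sub}(A,\bigvee_i V_i)=\bigvee_i\mathrm{sub}(A,V_i)$ for every family $(V_i)$ of open sets. $X$ is strong locally super-compact if it has a base consisting of super-compact open sets. A point of $\mathcal O(X)$ is a map $p:\mathcal O(X)\to L$ preserving binary meets and arbitrary joins and satisfying $p(\lambda_X)=\lambda$ for every constant map $\lambda_X$, $\lambda\in L$. $X$ is $L$-sober if $x\mapsto[x]$,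 $[x](A)=A(x)$, is a bijection from $X$ onto the set of points of $\mathcal O(X)$; an $L$-sober space is $T_0$, that is, its points are separated by the open sets. **The assignments.** For an $L$-ordered set $P$, let $\Sigma_L P$ be the set $P$ with the Scott $L$-topology, whose open sets are the $A\in L^P$ with $A(x)\wedge e(x,y)\le A(y)$ for all $x,y$ and $A(\sqcup D)=\bigvee_x A(x)\wedge D(x)$ for every directed $D$ having a supremum. For a $T_0$ $L$-topological space $X$, let $\Omega_L X$ be the set $X$ with the specialization $L$-order $e(x,y)=\bigwedge_{A\in\mathcal O(X)}(A(x)\to A(y))$. **Theorem.** Let $L\text{-}\mathbf{SLSCSob}$ be the category of strong locally super-compact $L$-sober spaces with continuous maps and $L\text{-}\mathbf{AlgDom}$ the category of algebraic $L$-dcpo's with Scott continuous maps. The assignments $P\mapsto\Sigma_L P$ and $X\mapsto\Omega_L X$ on objects, each leaving the underlying map of a morphism unchanged, are functors $\Sigma_L:L\text{-}\mathbf{AlgDom}\to L\text{-}\mathbf{SLSCSob}$ and $\Omega_L:L\text{-}\mathbf{SLSCSob}\to L\text{-}\mathbf{AlgDom}$, and $\Omega_L\circ\Sigma_L=\mathrm{id}$,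 $\Sigma_L\circ\Omega_L=\mathrm{id}$. In particular the two categories are isomorphic. -/

import Mathlib

open CategoryTheory

universe u v

namespace FrameDomain

/-! ### `L`-subsets -/

section LSubsets

variable {L : Type u} [Order.Frame L]

/-- The inclusion degree `sub(A, B) = ⋀ₓ A(x) → B(x)` of `L`-subsets. -/
def sub {X : Type v} (A B : X → L) : L := ⨅ x, A x ⇨ B x

/-- An `L`-subset is nonempty if `⋁ₓ A(x) = 1`. -/
def IsNonempty {X : Type v} (A : X → L) : Prop := ⨆ x, A x = ⊤

/-- Zadeh extension: `f^→(A)(y) = ⋁_{f(x) = y} A(x)`. -/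
def zadeh {X Y : Type v} (f : X → Y) (A : X → L) : Y → L :=
  fun y => ⨆ (x : X) (_ : f x = y), A x

end LSubsets

/-! ### `L`-ordered sets -/

/-- An `L`-order on `P`. -/
structure LOrder (L : Type u) [Order.Frame L] (P : Type v) where
  e : P → P → L
  refl : ∀ x, e x x = ⊤
  trans : ∀ x y z, e x y ⊓ e y z ≤ e x z
  antisymm : ∀ x y, e x y ⊓ e y x = ⊤ → x = y

namespace LOrder

variable {L : Type u} [Order.Frame L] {P : Type v} (E : LOrder L P)

/-- `↓x`, i.e. `y ↦ e(y, x)`. -/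
def down (x : P) : P → L := fun y => E.e y x

/-- `A` is an upper set. -/
def IsUpper (A : P → L) : Prop := ∀ x y, A x ⊓ E.e x y ≤ A y

/-- `x = ⊔ A`: for all `y`, `e(x, y) = sub(A, ↓y)`. -/
def IsSup (A : P → L) (x : P) : Prop := ∀ y, E.e x y = sub A (E.down y)

/-- `D` is a directed `L`-subset. -/
def Directed (D : P → L) : Prop :=
  IsNonempty D ∧ ∀ x y, D x ⊓ D y ≤ ⨆ z, D z ⊓ E.e x z ⊓ E.e y z

/-- `P` is an `L`-dcpo. -/
def IsDcpo : Prop := ∀ D : P → L, E.Directed D → ∃ x, E.IsSup D x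

/-- The way-below `L`-subset
`⇓x (y) = ⋀_D (e(x, ⊔D) → ⋁_d D(d) ∧ e(y, d))`, the meet being taken over the directed
`L`-subsets `D` that have a supremum (here called `s`). -/
def wayBelow (x : P) : P → L := fun y =>
  ⨅ (D : P → L) (s : P) (_ : E.Directed D ∧ E.IsSup D s),
    E.e x s ⇨ ⨆ d, D d ⊓ E.e y d

/-- Compact elements. -/
def IsCompactElt (x : P) : Prop := E.wayBelow x x = ⊤

open Classical in
/-- `k(x)(y) = e(y, x)` if `y` is compact, and `0` otherwise. -/
noncomputable def k (x : P) : P → L := fun y => if E.IsCompactElt y then E.e y x else ⊥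

/-- Algebraic `L`-dcpo's. -/
def IsAlgebraicDcpo : Prop :=
  E.IsDcpo ∧ ∀ x, E.Directed (E.k x) ∧ E.IsSup (E.k x) x

/-- Scott open `L`-subsets. -/
def IsScottOpen (A : P → L) : Prop :=
  E.IsUpper A ∧ ∀ (D : P → L) (s : P), E.Directed D → E.IsSup D s → A s = ⨆ x, A x ⊓ D x

theorem down_directed (x : P) : E.Directed (E.down x) := by
  refine ⟨top_le_iff.1 ?_, fun y z => ?_⟩
  · rw [← E.refl x]
    exact le_iSup (fun y => E.e y x) x
  · refine le_trans ?_ (le_iSup _ x)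
    simp [down, E.refl]

theorem down_isSup (x : P) : E.IsSup (E.down x) x := by
  intro y
  apply le_antisymm
  · refine le_iInf fun z => le_himp_iff.2 ?_
    rw [inf_comm]
    exact E.trans z x y
  · refine (iInf_le _ x).trans ?_
    simp [down, E.refl]

theorem le_of_isSup {A : P → L} {x : P} (h : E.IsSup A x) (y : P) : A y ≤ E.e y x := by
  have h1 : (⊤ : L) ≤ A y ⇨ E.e y x := by
    rw [← E.refl x, h x]
    exact iInf_le _ y
  simpa using h1

end LOrder

section Scott

variable {L : Type u} [Order.Frame L] {P Q R : Type v}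

/-- Scott continuous maps: `f(⊔D)` is the supremum of `f^→(D)` for every directed `D` that has
a supremum. -/
def ScottCont (E : LOrder L P) (F : LOrder L Q) (f : P → Q) : Prop :=
  ∀ (D : P → L) (s : P), E.Directed D → E.IsSup D s → F.IsSup (zadeh f D) (f s)

theorem le_zadeh (f : P → Q) (A : P → L) (x : P) : A x ≤ zadeh f A (f x) :=
  le_iSup₂_of_le (f := fun (z : P) (_ : f z = f x) => A z) x rfl le_rfl

theorem zadeh_id (A : P → L) : zadeh (fun x => x) A = A := by
  funext y
  simp [zadeh]

theorem zadeh_comp (f : P → Q) (g : Q → R) (A : P → L) :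
    zadeh (fun x => g (f x)) A = zadeh g (zadeh f A) := by
  funext r
  apply le_antisymm
  · refine iSup₂_le fun x hx => ?_
    subst hx
    exact (le_zadeh f A x).trans (le_zadeh g _ _)
  · refine iSup₂_le fun y hy => iSup₂_le fun x hx => ?_
    subst hx
    subst hy
    exact le_zadeh (fun x => g (f x)) A x

theorem ScottCont.mono {E : LOrder L P} {F : LOrder L Q} {f : P → Q} (hf : ScottCont E F f)
    (x y : P) : E.e x y ≤ F.e (f x) (f y) :=
  (le_zadeh f (E.down y) x).trans
    (F.le_of_isSup (hf _ y (E.down_directed y) (E.down_isSup y)) (f x))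

theorem ScottCont.directed {E : LOrder L P} {F : LOrder L Q} {f : P → Q} (hf : ScottCont E F f)
    {D : P → L} (hD : E.Directed D) : F.Directed (zadeh f D) := by
  refine ⟨top_le_iff.1 ?_, fun a b => ?_⟩
  · rw [← hD.1]
    exact iSup_le fun x => (le_zadeh f D x).trans (le_iSup (zadeh f D) (f x))
  · simp only [zadeh, iSup_inf_eq, inf_iSup_eq]
    refine iSup₂_le fun x hx => iSup₂_le fun y hy => ?_
    subst hx
    subst hy
    refine (hD.2 _ _).trans (iSup_le fun z => ?_)
    refine le_iSup_of_le (f z) (le_iSup₂_of_le z rfl ?_)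
    exact inf_le_inf (inf_le_inf le_rfl (hf.mono _ _)) (hf.mono _ _)

theorem ScottCont.id (E : LOrder L P) : ScottCont E E (fun x => x) := by
  intro D s _ hs
  rw [zadeh_id]
  exact hs

theorem ScottCont.comp {E : LOrder L P} {F : LOrder L Q} {G : LOrder L R} {f : P → Q} {g : Q → R}
    (hf : ScottCont E F f) (hg : ScottCont F G g) : ScottCont E G (fun x => g (f x)) := by
  intro D s hD hs
  rw [zadeh_comp]
  exact hg _ _ (hf.directed hD) (hf D s hD hs)

end Scott

/-- An `L`-ordered set. -/
structure LPos (L : Type u) [Order.Frame L] where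
  carrier : Type v
  ord : LOrder L carrier

/-- A Scott continuous map between `L`-ordered sets. -/
@[ext]
structure LPos.Hom {L : Type u} [Order.Frame L] (P Q : LPos.{u, v} L) where
  toFun : P.carrier → Q.carrier
  cont : ScottCont P.ord Q.ord toFun

/-- The category of `L`-ordered sets and Scott continuous maps. -/
instance LPos.category (L : Type u) [Order.Frame L] : Category.{v} (LPos.{u, v} L) where
  Hom P Q := LPos.Hom P Q
  id P := ⟨fun x => x, ScottCont.id P.ord⟩
  comp f g := ⟨fun x => g.toFun (f.toFun x), f.cont.comp g.cont⟩

/-- The underlying-set functor. -/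
def LPos.forget (L : Type u) [Order.Frame L] : LPos.{u, v} L ⥤ Type v where
  obj P := P.carrier
  map f := TypeCat.ofHom (LPos.Hom.toFun f)

/-! ### `L`-topological spaces -/

/-- A (stratified) `L`-topology on `X`. -/
structure LTopology (L : Type u) [Order.Frame L] (X : Type v) where
  opens : Set (X → L)
  inf_mem : ∀ A B, A ∈ opens → B ∈ opens → A ⊓ B ∈ opens
  sSup_mem : ∀ S : Set (X → L), S ⊆ opens → sSup S ∈ opens
  const_mem : ∀ a : L, (fun _ => a) ∈ opens

namespace LTopology

variable {L : Type u} [Order.Frame L] {X : Type v} (T : LTopology L X)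

/-- `X` is `T₀`. -/
def IsT0 : Prop := ∀ x y, (∀ A ∈ T.opens, A x = A y) → x = y

/-- `B` is a base: it consists of open sets, and every open set is a join of a family
`a_j ∧ B_j` with `B_j` in the base and `a_j` in `L`. -/
def IsBase (B : Set (X → L)) : Prop :=
  B ⊆ T.opens ∧ ∀ A ∈ T.opens, ∃ J : Set ((X → L) × L),
    (∀ j ∈ J, j.1 ∈ B) ∧ A = ⨆ j ∈ J, fun x => j.2 ⊓ j.1 x

/-- Super-compact `L`-subsets. -/
def IsSuperCompact (A : X → L) : Prop :=
  IsNonempty A ∧ ∀ V : Set (X → L), V ⊆ T.opens → sub A (sSup V) = ⨆ U ∈ V, sub A U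

/-- Strong locally super-compact: there is a base of super-compact open sets. -/
def IsStrongLocallySuperCompact : Prop :=
  ∃ B : Set (X → L), T.IsBase B ∧ ∀ A ∈ B, T.IsSuperCompact A

/-- The points of the `L`-frame `O(X)`: the maps `O(X) → L` that preserve binary meets, arbitrary
joins and constants. -/
@[ext]
structure Point where
  toFun : T.opens → L
  map_inf : ∀ A B : T.opens,
    toFun ⟨A.1 ⊓ B.1, T.inf_mem _ _ A.2 B.2⟩ = toFun A ⊓ toFun B
  map_sSup : ∀ (S : Set (X → L)) (hS : S ⊆ T.opens),
    toFun ⟨sSup S, T.sSup_mem S hS⟩ = ⨆ (A : X → L) (hA : A ∈ S), toFun ⟨A, hS hA⟩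
  map_const : ∀ a : L, toFun ⟨fun _ => a, T.const_mem a⟩ = a

/-- The point `[x]`, given by `[x](A) = A(x)`. -/
def eta (x : X) : T.Point where
  toFun A := A.1 x
  map_inf _ _ := rfl
  map_sSup S hS := by simp [sSup_apply, iSup_subtype]
  map_const _ := rfl

/-- `L`-sober: `x ↦ [x]` is a bijection from `X` to the set of points of `O(X)`. -/
def IsSober : Prop := Function.Bijective T.eta

theorem IsSober.isT0 {T : LTopology L X} (h : T.IsSober) : T.IsT0 := by
  intro x y hxy
  apply h.1
  ext A
  exact hxy A.1 A.2

/-- The specialization `L`-order `e(x, y) = ⋀_{A ∈ O(X)} A(x) → A(y)` of a `T₀` space. -/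
def specialization (h : T.IsT0) : LOrder L X where
  e x y := ⨅ A ∈ T.opens, A x ⇨ A y
  refl x := by simp
  trans x y z := by
    refine le_iInf₂ fun A hA => ?_
    refine (inf_le_inf (iInf₂_le A hA) (iInf₂_le A hA)).trans ?_
    exact himp_triangle _ _ _
  antisymm x y hxy := by
    apply h
    intro A hA
    obtain ⟨h1, h2⟩ := inf_eq_top_iff.1 hxy
    apply le_antisymm
    · exact himp_eq_top_iff.1 (top_le_iff.1 (h1 ▸ iInf₂_le A hA))
    · exact himp_eq_top_iff.1 (top_le_iff.1 (h2 ▸ iInf₂_le A hA))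

end LTopology

/-- Continuity of a map between `L`-topological spaces. -/
def LCont {L : Type u} [Order.Frame L] {X Y : Type v} (T : LTopology L X) (U : LTopology L Y)
    (f : X → Y) : Prop :=
  ∀ B ∈ U.opens, (fun x => B (f x)) ∈ T.opens

/-- An `L`-topological space. -/
structure LTop (L : Type u) [Order.Frame L] where
  carrier : Type v
  top : LTopology L carrier

/-- A continuous map between `L`-topological spaces. -/
@[ext]
structure LTop.Hom {L : Type u} [Order.Frame L] (X Y : LTop.{u, v} L) where
  toFun : X.carrier → Y.carrier
  cont : LCont X.top Y.top toFun

/-- The category of `L`-topological spaces and continuous maps. -/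
instance LTop.category (L : Type u) [Order.Frame L] : Category.{v} (LTop.{u, v} L) where
  Hom X Y := LTop.Hom X Y
  id X := ⟨fun x => x, fun _ hB => hB⟩
  comp f g := ⟨fun x => g.toFun (f.toFun x), fun B hB => f.cont _ (g.cont B hB)⟩

/-- The underlying-set functor. -/
def LTop.forget (L : Type u) [Order.Frame L] : LTop.{u, v} L ⥤ Type v where
  obj X := X.carrier
  map f := TypeCat.ofHom (LTop.Hom.toFun f)

/-- The Scott `L`-topology: its open sets are the Scott open `L`-subsets. -/
def LOrder.scott {L : Type u} [Order.Frame L] {P : Type v} (E : LOrder L P) : LTopology L P where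
  opens := {A | E.IsScottOpen A}
  inf_mem A B hA hB := by
    refine ⟨fun x y => ?_, fun D s hD hs => ?_⟩
    · refine le_inf ?_ ?_
      · exact (inf_le_inf_right _ inf_le_left).trans (hA.1 x y)
      · exact (inf_le_inf_right _ inf_le_right).trans (hB.1 x y)
    · apply le_antisymm
      · rw [Pi.inf_apply, hA.2 D s hD hs, hB.2 D s hD hs]
        rw [iSup_inf_iSup]
        refine iSup_le fun ⟨x, y⟩ => ?_
        rw [inf_inf_inf_comm]
        refine (inf_le_inf_left _ (hD.2 x y)).trans ?_
        rw [inf_iSup_eq]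
        refine iSup_le fun z => le_iSup_of_le z (le_inf (le_inf ?_ ?_) ?_)
        · refine le_trans (le_inf ?_ ?_) (hA.1 x z)
          · exact inf_le_left.trans inf_le_left
          · exact inf_le_right.trans (inf_le_left.trans inf_le_right)
        · refine le_trans (le_inf ?_ ?_) (hB.1 y z)
          · exact inf_le_left.trans inf_le_right
          · exact inf_le_right.trans inf_le_right
        · exact inf_le_right.trans (inf_le_left.trans inf_le_left)
      · refine iSup_le fun x => le_inf ?_ ?_
        · rw [hA.2 D s hD hs]
          exact (inf_le_inf_right _ inf_le_left).trans (le_iSup (fun x => A x ⊓ D x) x)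
        · rw [hB.2 D s hD hs]
          exact (inf_le_inf_right _ inf_le_right).trans (le_iSup (fun x => B x ⊓ D x) x)
  sSup_mem S hS := by
    refine ⟨fun x y => ?_, fun D s hD hs => ?_⟩
    · simp only [sSup_apply, iSup_inf_eq]
      exact iSup_le fun A => le_iSup_of_le A ((hS A.2).1 x y)
    · simp only [sSup_apply, iSup_inf_eq]
      rw [iSup_comm]
      exact iSup_congr fun A => (hS A.2).2 D s hD hs
  const_mem a := by
    refine ⟨fun _ _ => inf_le_left, fun D s hD _ => ?_⟩
    have h : ⨆ x, D x = ⊤ := hD.1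
    rw [← inf_iSup_eq, h, inf_top_eq]

/-- The Scott space `Σ_L P`. -/
def LPos.scottSpace {L : Type u} [Order.Frame L] (P : LPos.{u, v} L) : LTop.{u, v} L :=
  ⟨P.carrier, P.ord.scott⟩

/-- The specialization `L`-ordered set `Ω_L X` of a `T₀` `L`-topological space. -/
def LTop.specSet {L : Type u} [Order.Frame L] (X : LTop.{u, v} L) (h : X.top.IsT0) :
    LPos.{u, v} L :=
  ⟨X.carrier, X.top.specialization h⟩

/-! ### The two categories -/

/-- Algebraic `L`-dcpo's, as a property of `L`-ordered sets. -/
def isAlgDom (L : Type u) [Order.Frame L] : ObjectProperty (LPos.{u, v} L) :=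
  fun P => P.ord.IsAlgebraicDcpo

/-- Strong locally super-compact `L`-sober spaces, as a property of `L`-topological spaces. -/
def isSLSCSob (L : Type u) [Order.Frame L] : ObjectProperty (LTop.{u, v} L) :=
  fun X => X.top.IsStrongLocallySuperCompact ∧ X.top.IsSober

/-- The category of algebraic `L`-dcpo's and Scott continuous maps. -/
abbrev AlgDom (L : Type u) [Order.Frame L] := (isAlgDom.{u, v} L).FullSubcategory

/-- The category of strong locally super-compact `L`-sober spaces and continuous maps. -/
abbrev SLSCSob (L : Type u) [Order.Frame L] := (isSLSCSob.{u, v} L).FullSubcategory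

end FrameDomain

/-!
A directed `L`-subset `D` defines a point `A ↦ ⋁ₓ A(x) ∧ D(x)` of any topology whose open sets are
upper sets. For the specialization order of a sober space this point is `[s]` for a unique `s`, and
`s` is the supremum of `D`, so directed suprema exist and open sets are Scott open. Conversely, if
the principal upper sets `e(c, ·)` that are open generate the topology, then restricting a point `p`
to them gives a directed `L`-subset `c ↦ p(e(c, ·))`, and `p` is recovered from it.

In the Scott topology of an algebraic `L`-dcpo the set `e(c, ·)` is open exactly when `c` is
compact, and algebraicity says that these sets generate; points then come from directed
`L`-subsets, so they come from suprema. In a sober space a super-compact open set `A` defines the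
point `V ↦ sub(A, V)`; this is `[c]` for some `c`, which forces `A = e(c, ·)`, so a super-compact
base is again a base of principal upper sets, and applying the restriction to the points `[x]`
gives the directed `L`-subsets required by algebraicity.
-/

namespace FrameDomain

section Overlap

variable {L : Type u} [Order.Frame L] {X Y : Type v}

/-- The degree `⋁ₓ A(x) ∧ D(x)` to which two `L`-subsets intersect. For a directed `D` it plays the
role of the limit of `A` along `D`: it is the right-hand side in the definition of Scott open
sets. -/
def overlap (A D : X → L) : L := ⨆ x, A x ⊓ D x

theorem overlap_const {D : X → L} (hD : IsNonempty D) (a : L) : overlap (fun _ => a) D = a := by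
  rw [overlap, ← inf_iSup_eq, show ⨆ x, D x = ⊤ from hD, inf_top_eq]

theorem overlap_top_eq_top_iff {D : X → L} : overlap (fun _ => ⊤) D = ⊤ ↔ IsNonempty D := by
  simp only [overlap, top_inf_eq, IsNonempty]

theorem overlap_sSup (S : Set (X → L)) (D : X → L) :
    overlap (sSup S) D = ⨆ A ∈ S, overlap A D := by
  simp only [overlap, sSup_apply, iSup_inf_eq, iSup_subtype]
  rw [iSup_comm]
  exact iSup_congr fun A => iSup_comm

theorem overlap_zadeh (f : X → Y) (B : Y → L) (D : X → L) :
    overlap B (zadeh f D) = overlap (fun x => B (f x)) D := by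
  simp only [overlap, zadeh, inf_iSup_eq]
  rw [iSup_comm]
  exact iSup_congr fun x => iSup_iSup_eq_right

theorem overlap_himp (A D : X → L) (a : L) : overlap A D ⇨ a = sub D fun x => A x ⇨ a := by
  simp only [overlap, sub, iSup_himp_eq, himp_himp, inf_comm]

end Overlap

section Order

variable {L : Type u} [Order.Frame L] {P Q : Type v} {E : LOrder L P} {F : LOrder L Q}

attribute [ext] LOrder LTopology

namespace LOrder

theorem IsSup.unique {A : P → L} {s t : P} (hs : E.IsSup A s) (ht : E.IsSup A t) : s = t := by
  apply E.antisymm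
  rw [hs t, ← ht t, ht s, ← hs s, E.refl, E.refl, inf_top_eq]

theorem isUpper_e (c : P) : E.IsUpper (E.e c) := fun x y => E.trans c x y

theorem IsUpper.sub_e {A : P → L} (hA : E.IsUpper A) (c : P) : sub (E.e c) A = A c := by
  apply le_antisymm
  · calc sub (E.e c) A ≤ E.e c c ⇨ A c := iInf_le _ c
      _ = A c := by rw [E.refl, top_himp]
  · exact le_iInf fun x => le_himp_iff.2 (hA c x)

theorem IsUpper.overlap_le {A D : P → L} (hA : E.IsUpper A) {s : P} (hs : E.IsSup D s) :
    overlap A D ≤ A s :=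
  iSup_le fun x => (inf_le_inf_left _ (E.le_of_isSup hs x)).trans (hA x s)

theorem Directed.overlap_inf {A B D : P → L} (hD : E.Directed D) (hA : E.IsUpper A)
    (hB : E.IsUpper B) : overlap (A ⊓ B) D = overlap A D ⊓ overlap B D := by
  apply le_antisymm
  · exact le_inf (iSup_mono fun x => inf_le_inf_right _ inf_le_left)
      (iSup_mono fun x => inf_le_inf_right _ inf_le_right)
  · simp only [overlap, iSup_inf_iSup]
    refine iSup_le fun ⟨x, y⟩ => ?_
    calc A x ⊓ D x ⊓ (B y ⊓ D y)
        = A x ⊓ B y ⊓ (D x ⊓ D y) := inf_inf_inf_comm _ _ _ _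
      _ ≤ A x ⊓ B y ⊓ ⨆ z, D z ⊓ E.e x z ⊓ E.e y z := inf_le_inf_left _ (hD.2 x y)
      _ = ⨆ z, (A x ⊓ E.e x z) ⊓ (B y ⊓ E.e y z) ⊓ D z := by
        rw [inf_iSup_eq]
        exact iSup_congr fun z => by ac_rfl
      _ ≤ ⨆ z, (A ⊓ B) z ⊓ D z :=
        iSup_mono fun z => inf_le_inf_right _ (inf_le_inf (hA x z) (hB y z))

theorem isCompactElt_iff_le_overlap {c : P} :
    E.IsCompactElt c ↔
      ∀ D s, E.Directed D → E.IsSup D s → E.e c s ≤ overlap (E.e c) D := by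
  simp only [IsCompactElt, wayBelow, iInf_eq_top, himp_eq_top_iff, and_imp, overlap, inf_comm]

theorem isScottOpen_e_iff {c : P} : E.IsScottOpen (E.e c) ↔ E.IsCompactElt c := by
  rw [isCompactElt_iff_le_overlap]
  refine ⟨fun hc D s hD hs => (hc.2 D s hD hs).le, fun hc => ⟨isUpper_e c, fun D s hD hs => ?_⟩⟩
  exact (hc D s hD hs).antisymm ((isUpper_e c).overlap_le hs)

theorem k_apply (x c : P) : E.k x c = ⨆ _ : E.IsCompactElt c, E.e c x := by
  by_cases hc : E.IsCompactElt c <;> simp [k, hc]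

end LOrder

theorem ScottCont.lCont {f : P → Q} (hf : ScottCont E F f) : LCont E.scott F.scott f := by
  refine fun B hB => ⟨fun x y => ?_, fun D s hD hs => ?_⟩
  · exact (inf_le_inf_left _ (hf.mono x y)).trans (hB.1 _ _)
  · calc B (f s) = overlap B (zadeh f D) := hB.2 _ _ (hf.directed hD) (hf D s hD hs)
      _ = overlap (fun x => B (f x)) D := overlap_zadeh f B D

end Order

namespace LTopology

variable {L : Type u} [Order.Frame L] {X Y : Type v}
variable {T : LTopology L X} {U : LTopology L Y} {E : LOrder L X}

theorem const_inf_mem (a : L) {A : X → L} (hA : A ∈ T.opens) : (fun x => a ⊓ A x) ∈ T.opens :=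
  T.inf_mem _ _ (T.const_mem a) hA

theorem iSup_mem {ι : Type*} {A : ι → X → L} (hA : ∀ i, A i ∈ T.opens) : ⨆ i, A i ∈ T.opens :=
  T.sSup_mem _ (Set.range_subset_iff.2 hA)

theorem IsT0.eta_injective (h : T.IsT0) : Function.Injective T.eta := fun x y hxy =>
  h x y fun A hA => congrArg (fun p : T.Point => p.toFun ⟨A, hA⟩) hxy

namespace Point

theorem map_const_inf (p : T.Point) (a : L) {A : X → L} (hA : A ∈ T.opens) :
    p.toFun ⟨fun x => a ⊓ A x, const_inf_mem a hA⟩ = a ⊓ p.toFun ⟨A, hA⟩ :=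
  (p.map_inf ⟨fun _ => a, T.const_mem a⟩ ⟨A, hA⟩).trans (by rw [p.map_const])

theorem map_iSup {ι : Type*} (p : T.Point) {A : ι → X → L} (hA : ∀ i, A i ∈ T.opens) :
    p.toFun ⟨⨆ i, A i, iSup_mem hA⟩ = ⨆ i, p.toFun ⟨A i, hA i⟩ := by
  refine (p.map_sSup _ (Set.range_subset_iff.2 hA)).trans (le_antisymm ?_ ?_)
  · refine iSup₂_le ?_
    rintro _ ⟨i, rfl⟩
    exact le_iSup (fun i => p.toFun ⟨A i, hA i⟩) i
  · exact iSup_le fun i => le_iSup₂_of_le (A i) ⟨i, rfl⟩ le_rfl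

/-- The point `A ↦ ⋁ₓ A(x) ∧ D(x)` given by a directed `L`-subset `D`, for an order with respect to
which all open sets are upper sets. -/
def ofDirected (hT : ∀ A ∈ T.opens, E.IsUpper A) {D : X → L} (hD : E.Directed D) : T.Point where
  toFun A := overlap A.1 D
  map_inf A B := hD.overlap_inf (hT _ A.2) (hT _ B.2)
  map_sSup S _ := overlap_sSup S D
  map_const := overlap_const hD.1

/-- The `L`-subset `c ↦ p(e(c, ·))` given by a point `p`, extended by `0` to the elements `c` for
which `e(c, ·)` is not open. For `p = [x]` it is the part of `↓x` on the remaining elements. -/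
def trace (E : LOrder L X) (p : T.Point) (c : X) : L :=
  ⨆ hc : E.e c ∈ T.opens, p.toFun ⟨E.e c, hc⟩

theorem overlap_trace (p : T.Point) (A : X → L) :
    overlap A (p.trace E) = ⨆ c : {c // E.e c ∈ T.opens}, A c ⊓ p.toFun ⟨E.e c, c.2⟩ := by
  simp only [overlap, trace, inf_iSup_eq, iSup_subtype]

end Point

/-- The open principal upper sets `e(c, ·)` generate the topology in the canonical way: every open
`A` is the join of the sets `A(c) ∧ e(c, ·)`. -/
def HasPrincipalBase (T : LTopology L X) (E : LOrder L X) : Prop :=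
  ∀ A ∈ T.opens, A = ⨆ c : {c // E.e c ∈ T.opens}, fun x => A c ⊓ E.e c x

theorem IsBase.hasPrincipalBase {B : Set (X → L)} (hB : T.IsBase B)
    (hT : ∀ A ∈ T.opens, E.IsUpper A) (hp : ∀ A ∈ B, ∃ c, A = E.e c) :
    T.HasPrincipalBase E := by
  intro A hA
  refine le_antisymm ?_ (iSup_le fun c x => hT A hA c x)
  obtain ⟨J, hJB, hAJ⟩ := hB.2 A hA
  conv_lhs => rw [hAJ]
  refine iSup₂_le fun ⟨C, a⟩ hj => ?_
  obtain ⟨c, rfl⟩ := hp C (hJB _ hj)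
  have ha : a ≤ A c := by
    calc a = a ⊓ E.e c c := by rw [E.refl, inf_top_eq]
      _ ≤ (⨆ j ∈ J, fun x => j.2 ⊓ j.1 x : X → L) c :=
        le_iSup₂ (f := fun (j : (X → L) × L) (_ : j ∈ J) (x : X) => j.2 ⊓ j.1 x) (E.e c, a) hj c
      _ = A c := by rw [← hAJ]
  exact le_iSup_of_le ⟨c, hB.1 (hJB _ hj)⟩ fun x => inf_le_inf_right _ ha

namespace HasPrincipalBase

theorem isUpper (h : T.HasPrincipalBase E) {A : X → L} (hA : A ∈ T.opens) : E.IsUpper A := by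
  intro x y
  rw [h A hA]
  simp only [iSup_apply, iSup_inf_eq, inf_assoc]
  exact iSup_mono fun c => inf_le_inf_left _ (E.trans c x y)

theorem isSuperCompact_e (h : T.HasPrincipalBase E) (c : X) : T.IsSuperCompact (E.e c) := by
  refine ⟨top_le_iff.1 ((E.refl c).ge.trans (le_iSup (E.e c) c)), fun V hV => ?_⟩
  calc sub (E.e c) (sSup V) = sSup V c := (h.isUpper (T.sSup_mem V hV)).sub_e c
    _ = ⨆ A ∈ V, A c := by rw [sSup_apply, iSup_subtype]
    _ = ⨆ A ∈ V, sub (E.e c) A := biSup_congr fun A hA => ((h.isUpper (hV hA)).sub_e c).symm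

theorem isStrongLocallySuperCompact (h : T.HasPrincipalBase E) :
    T.IsStrongLocallySuperCompact := by
  refine ⟨{A | ∃ c, E.e c ∈ T.opens ∧ A = E.e c}, ⟨?_, fun A hA => ?_⟩, ?_⟩
  · rintro _ ⟨c, hc, rfl⟩
    exact hc
  · refine ⟨Set.range fun c : {c // E.e c ∈ T.opens} => (E.e c, A c), ?_, ?_⟩
    · rintro _ ⟨c, rfl⟩
      exact ⟨c, c.2, rfl⟩
    · rw [iSup_range]
      exact h A hA
  · rintro _ ⟨c, -, rfl⟩
    exact h.isSuperCompact_e c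

theorem map_eq_overlap_trace (h : T.HasPrincipalBase E) (p : T.Point) {A : X → L}
    (hA : A ∈ T.opens) : p.toFun ⟨A, hA⟩ = overlap A (p.trace E) := by
  have hAc (c : {c // E.e c ∈ T.opens}) : (fun x => A c ⊓ E.e c x) ∈ T.opens :=
    const_inf_mem _ c.2
  calc p.toFun ⟨A, hA⟩ = p.toFun ⟨_, iSup_mem hAc⟩ := congrArg p.toFun (Subtype.ext (h A hA))
    _ = ⨆ c, p.toFun ⟨_, hAc c⟩ := p.map_iSup hAc
    _ = ⨆ c : {c // E.e c ∈ T.opens}, A c ⊓ p.toFun ⟨E.e c, c.2⟩ :=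
      iSup_congr fun c => p.map_const_inf (A c) c.2
    _ = overlap A (p.trace E) := (p.overlap_trace A).symm

theorem directed_trace (h : T.HasPrincipalBase E) (p : T.Point) : E.Directed (p.trace E) := by
  refine ⟨?_, fun x y => ?_⟩
  · rw [← overlap_top_eq_top_iff, ← h.map_eq_overlap_trace p (T.const_mem ⊤), p.map_const]
  · rw [Point.trace, Point.trace]
    simp only [iSup_inf_eq, inf_iSup_eq]
    refine iSup₂_le fun hy hx => le_of_eq ?_
    calc p.toFun ⟨E.e x, hx⟩ ⊓ p.toFun ⟨E.e y, hy⟩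
        = overlap (E.e x ⊓ E.e y) (p.trace E) :=
          (p.map_inf ⟨_, hx⟩ ⟨_, hy⟩).symm.trans (h.map_eq_overlap_trace p _)
      _ = ⨆ z, p.trace E z ⊓ E.e x z ⊓ E.e y z :=
          iSup_congr fun z => by rw [Pi.inf_apply, inf_comm, inf_assoc]

end HasPrincipalBase

end LTopology

namespace LOrder

variable {L : Type u} [Order.Frame L] {P : Type v} {E : LOrder L P}

theorem k_eq_trace (x : P) : E.k x = (E.scott.eta x).trace E :=
  funext fun c => (E.k_apply x c).trans (iSup_congr_Prop isScottOpen_e_iff.symm fun _ => rfl)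

namespace IsAlgebraicDcpo

theorem hasPrincipalBase_scott (hE : E.IsAlgebraicDcpo) : E.scott.HasPrincipalBase E := by
  refine fun A hA => funext fun x => ?_
  calc A x = overlap A (E.k x) := hA.2 _ x (hE.2 x).1 (hE.2 x).2
    _ = ⨆ c : {c // E.e c ∈ E.scott.opens}, A c ⊓ E.e c x := by
      rw [k_eq_trace, LTopology.Point.overlap_trace]
      rfl
    _ = _ := by rw [iSup_apply]

theorem iInf_scott_himp (hE : E.IsAlgebraicDcpo) (x y : P) :
    ⨅ A ∈ E.scott.opens, A x ⇨ A y = E.e x y := by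
  apply le_antisymm
  · rw [(hE.2 x).2 y]
    refine le_iInf fun c => ?_
    rw [E.k_apply, iSup_himp_eq]
    exact le_iInf fun hc => iInf₂_le (E.e c) (isScottOpen_e_iff.2 hc)
  · refine le_iInf₂ fun A hA => le_himp_iff.2 ?_
    rw [inf_comm]
    exact hA.1 x y

theorem isT0_scott (hE : E.IsAlgebraicDcpo) : E.scott.IsT0 := by
  intro x y hxy
  apply E.antisymm
  rw [← hE.iInf_scott_himp, ← hE.iInf_scott_himp, inf_eq_top_iff]
  constructor <;> simp +contextual only [hxy, himp_self, iInf_top]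

theorem isSober_scott (hE : E.IsAlgebraicDcpo) : E.scott.IsSober := by
  refine ⟨hE.isT0_scott.eta_injective, fun p => ?_⟩
  have hB := hE.hasPrincipalBase_scott
  obtain ⟨s, hs⟩ := hE.1 _ (hB.directed_trace p)
  refine ⟨s, LTopology.Point.ext (funext fun ⟨A, hA⟩ => ?_)⟩
  calc A s = overlap A (p.trace E) := hA.2 _ s (hB.directed_trace p) hs
    _ = p.toFun ⟨A, hA⟩ := (hB.map_eq_overlap_trace p hA).symm

theorem specialization_scott (hE : E.IsAlgebraicDcpo) (h : E.scott.IsT0) :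
    E.scott.specialization h = E :=
  LOrder.ext (funext₂ hE.iInf_scott_himp)

end IsAlgebraicDcpo

end LOrder

namespace LTopology

variable {L : Type u} [Order.Frame L] {X Y : Type v} {T : LTopology L X} {U : LTopology L Y}

theorem specialization_isUpper (h : T.IsT0) {A : X → L} (hA : A ∈ T.opens) :
    (T.specialization h).IsUpper A := by
  intro x y
  rw [inf_comm]
  exact le_himp_iff.1 (iInf₂_le A hA)

theorem isSup_specialization (h : T.IsT0) {D : X → L} {s : X}
    (hs : ∀ A ∈ T.opens, A s = overlap A D) : (T.specialization h).IsSup D s := by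
  intro y
  calc ⨅ A ∈ T.opens, A s ⇨ A y
      = ⨅ A ∈ T.opens, sub D fun x => A x ⇨ A y :=
        biInf_congr fun A hA => by rw [hs A hA, overlap_himp]
    _ = ⨅ x, ⨅ A ∈ T.opens, D x ⇨ (A x ⇨ A y) := by
        simp only [sub, iInf_comm (ι := X)]
    _ = sub D ((T.specialization h).down y) := by
        simp only [sub, LOrder.down, specialization, himp_iInf_eq]

/-- The point `V ↦ sub(A, V)` given by a super-compact `L`-subset `A`. -/
def IsSuperCompact.point {A : X → L} (hA : T.IsSuperCompact A) : T.Point where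
  toFun V := sub A V.1
  map_inf V W := by simp only [sub, Pi.inf_apply, himp_inf_distrib, iInf_inf_eq]
  map_sSup := hA.2
  map_const a := by rw [sub, ← iSup_himp_eq, show ⨆ x, A x = ⊤ from hA.1, top_himp]

namespace IsSober

theorem exists_forall_apply_eq (hT : T.IsSober) (p : T.Point) :
    ∃ s, ∀ (A : X → L) (hA : A ∈ T.opens), A s = p.toFun ⟨A, hA⟩ := by
  obtain ⟨s, rfl⟩ := hT.2 p
  exact ⟨s, fun _ _ => rfl⟩

theorem exists_isSup (hT : T.IsSober) {D : X → L}
    (hD : (T.specialization hT.isT0).Directed D) :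
    ∃ s, (T.specialization hT.isT0).IsSup D s ∧ ∀ A ∈ T.opens, A s = overlap A D := by
  obtain ⟨s, hs⟩ := hT.exists_forall_apply_eq
    (Point.ofDirected (fun _ => specialization_isUpper hT.isT0) hD)
  exact ⟨s, isSup_specialization hT.isT0 hs, hs⟩

theorem isScottOpen (hT : T.IsSober) {A : X → L} (hA : A ∈ T.opens) :
    (T.specialization hT.isT0).IsScottOpen A := by
  refine ⟨specialization_isUpper _ hA, fun D s hD hs => ?_⟩
  obtain ⟨t, ht, hAt⟩ := hT.exists_isSup hD
  rw [hs.unique ht]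
  exact hAt A hA

theorem scottCont_specialization (hT : T.IsSober) (hU : U.IsT0) {f : X → Y} (hf : LCont T U f) :
    ScottCont (T.specialization hT.isT0) (U.specialization hU) f := by
  refine fun D s hD hs => isSup_specialization hU fun B hB => ?_
  rw [overlap_zadeh]
  exact (hT.isScottOpen (hf B hB)).2 D s hD hs

theorem exists_eq_e (hT : T.IsSober) {A : X → L} (hA : A ∈ T.opens) (hc : T.IsSuperCompact A) :
    ∃ c, A = (T.specialization hT.isT0).e c := by
  obtain ⟨c, hcV⟩ := hT.exists_forall_apply_eq hc.point
  have hAc : A c = ⊤ := by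
    rw [hcV A hA]
    simp only [IsSuperCompact.point, sub, himp_self, iInf_top]
  refine ⟨c, funext fun y => le_antisymm (le_iInf₂ fun V hV => ?_) ?_⟩
  · rw [hcV V hV, le_himp_comm]
    exact iInf_le _ y
  · calc (T.specialization hT.isT0).e c y ≤ A c ⇨ A y := iInf₂_le A hA
      _ = A y := by rw [hAc, top_himp]

theorem hasPrincipalBase (hT : T.IsSober) (hS : T.IsStrongLocallySuperCompact) :
    T.HasPrincipalBase (T.specialization hT.isT0) := by
  obtain ⟨B, hB, hBc⟩ := hS
  exact hB.hasPrincipalBase (fun _ => specialization_isUpper hT.isT0)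
    fun A hA => hT.exists_eq_e (hB.1 hA) (hBc A hA)

theorem isSup_trace_eta (hT : T.IsSober) (hS : T.IsStrongLocallySuperCompact) (x : X) :
    (T.specialization hT.isT0).IsSup ((T.eta x).trace (T.specialization hT.isT0)) x :=
  isSup_specialization _ fun _ => (hT.hasPrincipalBase hS).map_eq_overlap_trace (T.eta x)

theorem scott_specialization (hT : T.IsSober) (hS : T.IsStrongLocallySuperCompact) :
    (T.specialization hT.isT0).scott = T := by
  refine LTopology.ext (Set.Subset.antisymm (fun A hA => ?_) fun A hA => hT.isScottOpen hA)
  set E := T.specialization hT.isT0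
  have hAE : A = ⨆ c : {c // E.e c ∈ T.opens}, fun x => A c ⊓ E.e c x := by
    funext x
    rw [hA.2 _ x ((hT.hasPrincipalBase hS).directed_trace (T.eta x)) (hT.isSup_trace_eta hS x),
      iSup_apply]
    exact Point.overlap_trace _ A
  rw [hAE]
  exact iSup_mem fun c => const_inf_mem (A c) c.2

theorem isAlgebraicDcpo (hT : T.IsSober) (hS : T.IsStrongLocallySuperCompact) :
    (T.specialization hT.isT0).IsAlgebraicDcpo := by
  refine ⟨fun D hD => ?_, fun x => ?_⟩
  · obtain ⟨s, hs, -⟩ := hT.exists_isSup hD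
    exact ⟨s, hs⟩
  · rw [LOrder.k_eq_trace, hT.scott_specialization hS]
    exact ⟨(hT.hasPrincipalBase hS).directed_trace _, hT.isSup_trace_eta hS x⟩

end IsSober

end LTopology

section Functors

variable (L : Type u) [Order.Frame L]

/-- The functor `Σ_L`, sending an algebraic `L`-dcpo to its Scott space. -/
def scottFunctor : AlgDom.{u, v} L ⥤ SLSCSob.{u, v} L where
  obj P := ⟨P.obj.scottSpace, P.property.hasPrincipalBase_scott.isStrongLocallySuperCompact,
    P.property.isSober_scott⟩
  map f := ObjectProperty.homMk ⟨f.hom.toFun, f.hom.cont.lCont⟩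

/-- The functor `Ω_L`, sending a strong locally super-compact `L`-sober space to its specialization
`L`-order. -/
def specializationFunctor : SLSCSob.{u, v} L ⥤ AlgDom.{u, v} L where
  obj X := ⟨X.obj.specSet X.property.2.isT0, X.property.2.isAlgebraicDcpo X.property.1⟩
  map {X Y} f := ObjectProperty.homMk
    ⟨f.hom.toFun, X.property.2.scottCont_specialization Y.property.2.isT0 f.hom.cont⟩

instance : (LPos.forget.{u, v} L).Faithful where
  map_injective h := LPos.Hom.ext (funext fun x => ConcreteCategory.congr_hom h x)

instance : (LTop.forget.{u, v} L).Faithful where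
  map_injective h := LTop.Hom.ext (funext fun x => ConcreteCategory.congr_hom h x)

theorem functor_eq_of_comp_faithful {C D E : Type*} [Category C] [Category D] [Category E]
    {F G : C ⥤ D} (U : D ⥤ E) [U.Faithful] (h : ∀ X, F.obj X = G.obj X)
    (hU : F ⋙ U = G ⋙ U) : F = G := by
  refine CategoryTheory.Functor.ext h fun X Y f => U.map_injective ?_
  simpa only [Functor.comp_map, Functor.map_comp, eqToHom_map] using
    CategoryTheory.Functor.congr_hom hU f

theorem scottFunctor_comp_specializationFunctor :
    scottFunctor.{u, v} L ⋙ specializationFunctor L = 𝟭 _ := by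
  refine functor_eq_of_comp_faithful ((isAlgDom L).ι ⋙ LPos.forget L) (fun P => ?_) rfl
  obtain ⟨⟨P, E⟩, hE⟩ := P
  exact ObjectProperty.FullSubcategory.ext
    (congrArg (LPos.mk P) (LOrder.IsAlgebraicDcpo.specialization_scott hE _))

theorem specializationFunctor_comp_scottFunctor :
    specializationFunctor.{u, v} L ⋙ scottFunctor L = 𝟭 _ := by
  refine functor_eq_of_comp_faithful ((isSLSCSob L).ι ⋙ LTop.forget L) (fun X => ?_) rfl
  obtain ⟨⟨X, T⟩, hS, hT⟩ := X
  exact ObjectProperty.FullSubcategory.ext (congrArg (LTop.mk X) (hT.scott_specialization hS))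

end Functors

end FrameDomain

theorem mainTheorem2 (L : Type u) [Order.Frame L] :
    ∃ (S : FrameDomain.AlgDom.{u, v} L ⥤ FrameDomain.SLSCSob.{u, v} L)
      (W : FrameDomain.SLSCSob.{u, v} L ⥤ FrameDomain.AlgDom.{u, v} L),
      -- on objects the functors are `P ↦ Σ_L P` and `X ↦ Ω_L X`
      (∀ P, (S.obj P).obj = P.obj.scottSpace) ∧
      (∀ X, (W.obj X).obj = X.obj.specSet X.property.2.isT0) ∧
      -- on morphisms they do not change the underlying map
      S ⋙ (FrameDomain.isSLSCSob L).ι ⋙ FrameDomain.LTop.forget L =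
        (FrameDomain.isAlgDom L).ι ⋙ FrameDomain.LPos.forget L ∧
      W ⋙ (FrameDomain.isAlgDom L).ι ⋙ FrameDomain.LPos.forget L =
        (FrameDomain.isSLSCSob L).ι ⋙ FrameDomain.LTop.forget L ∧
      -- they are mutually inverse
      S ⋙ W = 𝟭 _ ∧ W ⋙ S = 𝟭 _ := by
  exact ⟨FrameDomain.scottFunctor L, FrameDomain.specializationFunctor L,
    fun _ => rfl, fun _ => rfl, rfl, rfl,
    FrameDomain.scottFunctor_comp_specializationFunctor L,
    FrameDomain.specializationFunctor_comp_scottFunctor L⟩
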